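/- Let $d\ge 1$, let $\mathbf n=(n_1,\dots,n_d)$ be a tuple of positive integers, and let $\rho\in[d]=\{1,\dots,d\}$. Let $\mathcal T_\rho(\mathbf n)$ be the set of rooted trees (connected acyclic graphs with a distinguished root vertex) with vertex set $\{(t,i) : t\in[d],\ i\in[n_t]\}$ whose root is of the form $(\rho,i)$. The vertex $(t,i)$ is said to have type $t$. Edges are oriented toward the root, so that each edge goes from a child to its parent. A vertex has indegree type $\mathbf c=(c_1,\dots,c_d)$ if it has exactly $c_s$ children of type $s$ for every $s\in[d]$. Let $\mathcal C=\{0,1,\dots,n_1\}\times\cdots\times\{0,1,\dots,n_d\}$, and let $\mathbf N=(N_{t,\mathbf c})_{t\in[d],\,\mathbf c\in\mathcal C}$ be a tuple of non-negative integers such that $\sum_{\mathbf c\in\mathcal C}N_{t,\mathbf c}=n_t$ for all $t\in[d]$. For $s,t\in[d]$ and $k\ge 0$ put $$m_{s,t}=\sum_{\mathbf c\in\mathcal C}c_s\,N_{t,\mathbf c},\qquad N(k)=\sum_{\substack{s,t\in[d],\ \mathbf c\in\mathcal C\\ c_s=k}}N_{t,\mathbf c}.$$ Let $\mathcal T_\rho^{\mathbf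 N}$ be the set of trees in $\mathcal T_\rho(\mathbf n)$ having, for all $t\in[d]$ and $\mathbf c\in\mathcal C$, exactly $N_{t,\mathbf c}$ vertices of type $t$ with indegree type $\mathbf c$. Let $\mathrm{Cay}_d^\rho$ be the set of trees with vertex set $[d]$ rooted at the vertex $\rho$, with edges oriented toward $\rho$; for $A\in\mathrm{Cay}_d^\rho$, write $(s,t)\in A$ if the edge oriented from $s$ to $t$ belongs to $A$. If $$n_s=\delta_{s,\rho}+\sum_{t\in[d]}m_{s,t}\quad\text{for all } s\in[d]$$ (where $\delta$ is the Kronecker delta), then $$|\mathcal T_\rho^{\mathbf N}|=\frac{\prod_{t\in[d]}n_t!\,(n_t-1)!}{\prod_{t\in[d],\,\mathbf c\in\mathcal C}N_{t,\mathbf c}!\ \prod_{k\ge 0}k!^{N(k)}}\ \sum_{A\in\mathrm{Cay}_d^\rho}\ \prod_{(s,t)\in A}m_{s,t};$$ otherwise $|\mathcal T_\rho^{\mathbf N}|=0$. -/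

import Mathlib

namespace MultitypeCayley

/-- A rooted tree with vertex set `V`: a connected acyclic graph with a distinguished vertex. -/
@[ext]
structure RootedTree (V : Type*) where
  graph : SimpleGraph V
  root : V
  isTree : graph.IsTree

/-- `T.Arc w v`: orienting the edges of `T` toward the root, `(w, v)` is an oriented edge
of `T`. Equivalently, `w` is a child of `v`: the vertices are adjacent and `w` is the one
farther from the root. -/
def RootedTree.Arc {V : Type*} (T : RootedTree V) (w v : V) : Prop :=
  T.graph.Adj w v ∧ T.graph.dist w T.root = T.graph.dist v T.root + 1

instance {V : Type*} [Finite V] : Finite (RootedTree V) :=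
  Finite.of_injective (fun T : RootedTree V => (T.graph, T.root)) (by
    intro S T h
    rw [Prod.mk.injEq] at h
    exact RootedTree.ext h.1 h.2)

noncomputable instance {V : Type*} [Finite V] : Fintype (RootedTree V) :=
  Fintype.ofFinite _

/-- The vertex set of profile `n`: pairs (type, label), with `n t` labels for the type `t`. -/
abbrev Vertex {d : ℕ} (n : Fin d → ℕ) : Type := Σ t : Fin d, Fin (n t)

open Classical in
/-- The rooted multitype Cayley trees of profile `n` in which the root vertex has type `ρ`. -/
noncomputable def multitypeTrees {d : ℕ} (n : Fin d → ℕ) (ρ : Fin d) :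
    Finset (RootedTree (Vertex n)) :=
  {T | T.root.1 = ρ}

open Classical in
/-- The unitype Cayley trees with vertex set `Fin d` rooted at the vertex `ρ`. -/
noncomputable def cayleyTrees (d : ℕ) (ρ : Fin d) : Finset (RootedTree (Fin d)) :=
  {A | A.root = ρ}

open Classical in
/-- The set of edges of a tree, oriented toward its root. -/
noncomputable def RootedTree.arcs {V : Type*} [Fintype V] (A : RootedTree V) : Finset (V × V) :=
  {e | A.Arc e.1 e.2}

open Classical in
/-- The number of children of type `s` of the vertex `v`. -/
noncomputable def numChildren {d : ℕ} {n : Fin d → ℕ} (T : RootedTree (Vertex n))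
    (s : Fin d) (v : Vertex n) : ℕ :=
  Finset.card {w : Vertex n | w.1 = s ∧ T.Arc w v}

/-- The possible indegree types: tuples `c` with `0 ≤ c s ≤ n s` for all `s`. -/
abbrev IndegreeType {d : ℕ} (n : Fin d → ℕ) : Type := ∀ s : Fin d, Fin (n s + 1)

/-- The vertex `v` has indegree type `c`: it has `c s` children of type `s` for all `s`. -/
def HasIndegreeType {d : ℕ} {n : Fin d → ℕ} (T : RootedTree (Vertex n)) (v : Vertex n)
    (c : IndegreeType n) : Prop :=
  ∀ s, numChildren T s v = (c s : ℕ)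

open Classical in
/-- The trees in `multitypeTrees n ρ` having, for all `t` and `c`, exactly `N t c` vertices of
type `t` with indegree type `c`. -/
noncomputable def treesWithIndegreeTypes {d : ℕ} (n : Fin d → ℕ) (ρ : Fin d)
    (N : Fin d → IndegreeType n → ℕ) : Finset (RootedTree (Vertex n)) :=
  {T ∈ multitypeTrees n ρ |
    ∀ t c, Finset.card {i : Fin (n t) | HasIndegreeType T ⟨t, i⟩ c} = N t c}

/-- `m s t = ∑ c, c s * N t c`. -/
def edgeCount {d : ℕ} {n : Fin d → ℕ} (N : Fin d → IndegreeType n → ℕ) (s t : Fin d) : ℕ :=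
  ∑ c : IndegreeType n, (c s : ℕ) * N t c

/-- `N(k)`, the sum of `N t c` over all `s`, `t`, `c` such that `c s = k`. -/
def indegreeCount {d : ℕ} {n : Fin d → ℕ} (N : Fin d → IndegreeType n → ℕ) (k : ℕ) : ℕ :=
  ∑ s : Fin d, ∑ t : Fin d, ∑ c : IndegreeType n with (c s : ℕ) = k, N t c

/-- Only finitely many factors of `∏ k!^N(k)` differ from `1`, so that the product over all
`k ≥ 0` makes sense as a `finprod`. -/
theorem finite_mulSupport_factorial_pow_indegreeCount {d : ℕ} {n : Fin d → ℕ}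
    (N : Fin d → IndegreeType n → ℕ) :
    (Function.mulSupport fun k : ℕ => k.factorial ^ indegreeCount N k).Finite := by
  refine (Set.finite_Iic (∑ s, n s)).subset fun k hk => ?_
  by_contra hlt
  apply hk
  have h0 : indegreeCount N k = 0 := by
    refine Finset.sum_eq_zero fun s _ => Finset.sum_eq_zero fun t _ => ?_
    refine Finset.sum_eq_zero fun c hc => ?_
    exfalso
    have h1 : (c s : ℕ) = k := (Finset.mem_filter.mp hc).2
    have h2 : n s ≤ ∑ s, n s := Finset.single_le_sum (fun _ _ => Nat.zero_le _) (Finset.mem_univ s)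
    have h3 := (c s).isLt
    exact hlt (Set.mem_Iic.mpr (by omega))
  simp [h0]

end MultitypeCayley

/-! Prescribe first the indegrees of each labelled vertex, `c u s` children of type `s` at `u`. If
the `c u s` satisfy the edge-count condition and every type occurs, the number of such trees times
`∏ (c u s)!` is `∏ (n_t - 1)!` times the weighted sum over Cayley trees on the types
(`treeCount_mul_prod_factorial`). This depends on `c` only through `m` and the multiset of
indegrees, so all ways of distributing the indegree types over the vertices give the same count.
There are `∏ n_t! / ∏ N_{t,c}!` of them, and the theorem follows.

The fixed-indegree formula is proved by removing a vertex `v` with no children, of type `s`. Its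
parent `u` loses one child of type `s`, which lowers `m s (τ u)` by one. If other vertices of type
`s` remain, summing over `u` requires an identity for the tree sums of the lowered matrices
(`sum_mul_treeSum_dec`). It supplies the factor `n_s - 1`, which turns `(n_s - 2)!` into `(n_s -
1)!`. If `v` is alone in its type and is not the root, the type disappears with it, and `s` is a
leaf of weight one in the type tree. -/

namespace MultitypeCayley

/-! ### Rooted trees as parent functions -/

/-- A rooted tree given by its root and its parent function; the root is its own parent. -/
@[ext]
structure ParentMap (V : Type*) where
  root : V
  parent : V → V
  parent_root : parent root = root
  exists_iterate : ∀ v, ∃ k, parent^[k] v = root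

namespace ParentMap

variable {V : Type*}

instance [Finite V] : Finite (ParentMap V) :=
  Finite.of_injective (fun T : ParentMap V => (T.root, T.parent)) (by
    intro S T h
    rw [Prod.mk.injEq] at h
    exact ParentMap.ext h.1 h.2)

noncomputable instance [Finite V] : Fintype (ParentMap V) :=
  Fintype.ofFinite _

theorem parent_eq_self_iff (T : ParentMap V) {v : V} : T.parent v = v ↔ v = T.root := by
  refine ⟨fun h => ?_, fun h => h ▸ T.parent_root⟩
  obtain ⟨k, hk⟩ := T.exists_iterate v
  rwa [Function.iterate_fixed h] at hk

open Classical in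
/-- The number of steps from a vertex to the root. -/
noncomputable def depth (T : ParentMap V) (v : V) : ℕ := Nat.find (T.exists_iterate v)

theorem iterate_depth (T : ParentMap V) (v : V) : T.parent^[T.depth v] v = T.root := by
  classical exact Nat.find_spec (T.exists_iterate v)

theorem depth_root (T : ParentMap V) : T.depth T.root = 0 := by
  classical exact (Nat.find_eq_zero _).2 rfl

theorem depth_eq_succ (T : ParentMap V) {v : V} (hv : v ≠ T.root) :
    T.depth v = T.depth (T.parent v) + 1 := by
  classical
  refine (Nat.find_eq_iff _).2 ⟨?_, fun k hk h => ?_⟩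
  · rw [Function.iterate_succ_apply]
    exact T.iterate_depth _
  · cases k with
    | zero => exact hv h
    | succ k =>
      rw [Function.iterate_succ_apply] at h
      exact Nat.find_min (T.exists_iterate (T.parent v)) (Nat.lt_of_succ_lt_succ hk) h

/-- The graph whose edges join the vertices to their parents. -/
def graph (T : ParentMap V) : SimpleGraph V where
  Adj v w := v ≠ w ∧ (T.parent v = w ∨ T.parent w = v)
  symm := ⟨fun _ _ h => ⟨h.1.symm, h.2.symm⟩⟩
  loopless := ⟨fun _ h => h.1 rfl⟩

theorem adj_parent (T : ParentMap V) {v : V} (hv : v ≠ T.root) : T.graph.Adj v (T.parent v) :=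
  ⟨fun h => hv (T.parent_eq_self_iff.1 h.symm), Or.inl rfl⟩

theorem exists_walk (T : ParentMap V) (v : V) :
    ∃ p : T.graph.Walk v T.root, p.length = T.depth v := by
  induction h : T.depth v generalizing v with
  | zero =>
    have h1 := T.iterate_depth v
    rw [h] at h1
    obtain rfl : v = T.root := h1
    exact ⟨.nil, rfl⟩
  | succ k ih =>
    have hv : v ≠ T.root := fun hv => by simp [hv, depth_root] at h
    obtain ⟨p, hp⟩ := ih (T.parent v) (by have := T.depth_eq_succ hv; omega)
    exact ⟨.cons (T.adj_parent hv) p, by simp [hp]⟩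

theorem connected (T : ParentMap V) : T.graph.Connected := by
  have : Nonempty V := ⟨T.root⟩
  refine ⟨fun v w => ?_⟩
  obtain ⟨p, -⟩ := T.exists_walk v
  obtain ⟨q, -⟩ := T.exists_walk w
  exact ⟨p.append q.reverse⟩

theorem adj_iff (T : ParentMap V) {v w : V} : T.graph.Adj v w ↔
    (v ≠ T.root ∧ T.parent v = w) ∨ (w ≠ T.root ∧ T.parent w = v) := by
  refine ⟨fun ⟨hne, h⟩ => ?_, fun h => ?_⟩
  · rcases h with rfl | rfl
    · exact Or.inl ⟨fun hv => hne (T.parent_eq_self_iff.2 hv).symm, rfl⟩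
    · exact Or.inr ⟨fun hv => hne (T.parent_eq_self_iff.2 hv), rfl⟩
  · rcases h with ⟨h, rfl⟩ | ⟨h, rfl⟩
    · exact T.adj_parent h
    · exact (T.adj_parent h).symm

/-- Each edge joins a vertex to its parent, so one step of a walk changes the depth by exactly one.
-/
theorem depth_le_length (T : ParentMap V) {v w : V} (p : T.graph.Walk v w) :
    T.depth v ≤ T.depth w + p.length := by
  induction p with
  | nil => simp
  | cons h p ih =>
    rw [SimpleGraph.Walk.length_cons]
    rcases T.adj_iff.1 h with ⟨hr, rfl⟩ | ⟨hr, rfl⟩ <;> have := T.depth_eq_succ hr <;> omega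

theorem dist_root (T : ParentMap V) (v : V) : T.graph.dist v T.root = T.depth v := by
  apply le_antisymm
  · obtain ⟨p, hp⟩ := T.exists_walk v
    exact hp ▸ SimpleGraph.dist_le p
  · obtain ⟨p, hp⟩ := T.connected.exists_walk_length_eq_dist v T.root
    have := T.depth_le_length p
    rwa [depth_root, hp, zero_add] at this

/-- The graph is connected, and the non-root vertices map onto its edges, so it has at most `|V| -
1` of them. -/
theorem isTree [Finite V] (T : ParentMap V) : T.graph.IsTree := by
  classical
  refine SimpleGraph.isTree_iff_connected_and_card.2
    ⟨T.connected, le_antisymm ?_ T.connected.card_vert_le_card_edgeSet_add_one⟩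
  have : Nat.card T.graph.edgeSet ≤ Nat.card {v // v ≠ T.root} := by
    let f : {v // v ≠ T.root} → T.graph.edgeSet := fun v => ⟨s(v.1, T.parent v.1), T.adj_parent v.2⟩
    refine Nat.card_le_card_of_surjective f ?_
    rintro ⟨e, he⟩
    induction e with
    | _ v w =>
      have he' : T.graph.Adj v w := he
      rcases T.adj_iff.1 he' with ⟨h, rfl⟩ | ⟨h, rfl⟩
      · exact ⟨⟨v, h⟩, rfl⟩
      · exact ⟨⟨w, h⟩, Subtype.ext Sym2.eq_swap⟩
  have h2 : Nat.card {v // v ≠ T.root} + 1 = Nat.card V := by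
    have := Fintype.ofFinite V
    have : 0 < Fintype.card V := Fintype.card_pos_iff.2 ⟨T.root⟩
    rw [Nat.card_eq_fintype_card, Nat.card_eq_fintype_card, Fintype.card_subtype_compl,
      Fintype.card_subtype_eq]
    omega
  omega

/-- The rooted tree with a given parent function. -/
def toRootedTree [Finite V] (T : ParentMap V) : RootedTree V := ⟨T.graph, T.root, T.isTree⟩

theorem arc_toRootedTree [Finite V] (T : ParentMap V) (w v : V) :
    T.toRootedTree.Arc w v ↔ w ≠ T.root ∧ T.parent w = v := by
  simp only [RootedTree.Arc, toRootedTree, dist_root]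
  constructor
  · rintro ⟨h, hd⟩
    rcases T.adj_iff.1 h with h | ⟨hv, rfl⟩
    · exact h
    · have := T.depth_eq_succ hv
      omega
  · rintro ⟨h, rfl⟩
    exact ⟨T.adj_parent h, T.depth_eq_succ h⟩

end ParentMap

namespace RootedTree

variable {V : Type*}

theorem adj_iff (T : RootedTree V) {v w : V} : T.graph.Adj v w ↔ T.Arc v w ∨ T.Arc w v := by
  constructor
  · intro h
    have := T.isTree.dist_eq_dist_add_one_of_adj T.root h
    simp only [T.graph.dist_comm (u := T.root)] at this
    rcases this with h1 | h1
    · exact Or.inl ⟨h, h1⟩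
    · exact Or.inr ⟨h.symm, h1⟩
  · rintro (h | h)
    · exact h.1
    · exact h.1.symm

/-- The first step of a shortest path to the root gives a parent; a second parent would give a
second path to the root. -/
theorem existsUnique_arc (T : RootedTree V) {w : V} (hw : w ≠ T.root) : ∃! v, T.Arc w v := by
  classical
  obtain ⟨p, hp, hd⟩ := T.isTree.connected.exists_path_of_dist w T.root
  cases p with
  | nil => exact absurd rfl hw
  | @cons _ v _ h q =>
    refine ⟨v, ⟨h, ?_⟩, ?_⟩
    · have h1 := SimpleGraph.dist_le q
      rw [SimpleGraph.Walk.length_cons] at hd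
      rcases T.adj_iff.1 h with h | h
      · exact h.2
      · have := h.2
        omega
    · rintro u ⟨hu, hud⟩
      obtain ⟨q', hq', hd'⟩ := T.isTree.connected.exists_path_of_dist u T.root
      have hwq : w ∉ q'.support := fun hm => by
        have h1 := SimpleGraph.dist_le (q'.dropUntil w hm)
        have h2 := q'.length_dropUntil_le_length hm
        omega
      have hp' : (SimpleGraph.Walk.cons hu q').IsPath := hq'.cons hwq
      have := (T.isTree.isAcyclic.subsingleton_path w T.root).elim ⟨_, hp⟩ ⟨_, hp'⟩
      simp only [Subtype.mk.injEq, SimpleGraph.Walk.cons.injEq] at this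
      exact this.1.symm

open Classical in
/-- The parent of a vertex; the root is its own parent. -/
noncomputable def parent (T : RootedTree V) (w : V) : V :=
  if hw : w ≠ T.root then (T.existsUnique_arc hw).choose else w

theorem arc_parent (T : RootedTree V) {w : V} (hw : w ≠ T.root) : T.Arc w (T.parent w) := by
  rw [parent, dif_pos hw]
  exact (T.existsUnique_arc hw).choose_spec.1

/-- The parent function of a rooted tree. -/
noncomputable def toParentMap (T : RootedTree V) : ParentMap V where
  root := T.root
  parent := T.parent
  parent_root := by simp [parent]
  exists_iterate w := by
    induction h : T.graph.dist w T.root generalizing w with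
    | zero => exact ⟨0, T.isTree.connected.dist_eq_zero_iff.1 h⟩
    | succ k ih =>
      have hw : w ≠ T.root := fun hw => by simp [hw] at h
      obtain ⟨j, hj⟩ := ih (T.parent w) (by have := (T.arc_parent hw).2; omega)
      exact ⟨j + 1, hj⟩

theorem toParentMap_parent_iff (T : RootedTree V) (w v : V) :
    (w ≠ T.root ∧ T.toParentMap.parent w = v) ↔ T.Arc w v := by
  constructor
  · rintro ⟨hw, rfl⟩
    exact T.arc_parent hw
  · intro h
    have hw : w ≠ T.root := fun hw => by
      have := h.2
      simp [hw] at this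
    exact ⟨hw, (T.existsUnique_arc hw).unique (T.arc_parent hw) h⟩

end RootedTree

/-- Rooted trees on a finite vertex set correspond to parent functions. -/
noncomputable def rootedTreeEquiv (V : Type*) [Finite V] : RootedTree V ≃ ParentMap V where
  toFun := RootedTree.toParentMap
  invFun := ParentMap.toRootedTree
  left_inv T := by
    refine RootedTree.ext ?_ rfl
    ext v w
    rw [(T.toParentMap.toRootedTree).adj_iff, T.adj_iff, ParentMap.arc_toRootedTree,
      ParentMap.arc_toRootedTree]
    exact or_congr (T.toParentMap_parent_iff v w) (T.toParentMap_parent_iff w v)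
  right_inv T := by
    refine ParentMap.ext rfl ?_
    funext w
    by_cases hw : w = T.root
    · rw [hw, T.parent_root]
      exact T.toRootedTree.toParentMap.parent_root
    · exact ((T.toRootedTree.toParentMap_parent_iff w (T.parent w)).2
        ((T.arc_toRootedTree _ _).2 ⟨hw, rfl⟩)).2


namespace ParentMap

/-! ### Removing and attaching leaves -/

section Attach

variable {V : Type*}

/-- The vertex `v` is not the parent of any vertex. -/
def IsLeaf (T : ParentMap V) (v : V) : Prop := ∀ w, T.parent w ≠ v

/-- The loop at the root keeps the root from being a leaf, so the root must be ruled out: if it had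
no other child, no iterate of `parent` could reach it from another vertex. -/
theorem isLeaf_of_forall_ne_root [Nontrivial V] (T : ParentMap V) {v : V}
    (h : ∀ w, w ≠ T.root → T.parent w ≠ v) : T.IsLeaf v := by
  intro w hw
  by_cases hr : w = T.root
  · subst hr
    rw [T.parent_root] at hw
    subst hw
    obtain ⟨w, hw⟩ := exists_ne T.root
    have key : ∀ k, T.parent^[k] w ≠ T.root := by
      intro k
      induction k with
      | zero => exact hw
      | succ k ih =>
        rw [Function.iterate_succ_apply']
        exact h _ ih
    obtain ⟨k, hk⟩ := T.exists_iterate w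
    exact key k hk
  · exact h w hr hw

theorem IsLeaf.root_ne {T : ParentMap V} {v : V} (h : T.IsLeaf v) : T.root ≠ v :=
  fun hv => h T.root (T.parent_root.trans hv)

variable [DecidableEq V]

/-- Attach the vertex `v` as a child of `u` to a tree on the other vertices. -/
def attach (v : V) (q : ParentMap {w // w ≠ v}) (u : {w // w ≠ v}) : ParentMap V where
  root := q.root
  parent w := if hw : w = v then u else q.parent ⟨w, hw⟩
  parent_root := by rw [dif_neg q.root.2]; exact congrArg _ q.parent_root
  exists_iterate := by
    have key : ∀ (k : ℕ) (w : {w // w ≠ v}),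
        (fun w => if hw : w = v then (u : V) else q.parent ⟨w, hw⟩)^[k] w = q.parent^[k] w := by
      intro k
      induction k with
      | zero => exact fun _ => rfl
      | succ k ih =>
        intro w
        rw [Function.iterate_succ_apply, Function.iterate_succ_apply, dif_neg w.2]
        exact ih _
    intro w
    by_cases hw : w = v
    · obtain ⟨k, hk⟩ := q.exists_iterate u
      refine ⟨k + 1, ?_⟩
      rw [Function.iterate_succ_apply, dif_pos hw, key, hk]
    · obtain ⟨k, hk⟩ := q.exists_iterate ⟨w, hw⟩
      exact ⟨k, (key k ⟨w, hw⟩).trans (congrArg _ hk)⟩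

@[simp] theorem attach_root (v : V) (q : ParentMap {w // w ≠ v}) (u : {w // w ≠ v}) :
    (attach v q u).root = q.root := rfl

@[simp] theorem attach_parent_self (v : V) (q : ParentMap {w // w ≠ v}) (u : {w // w ≠ v}) :
    (attach v q u).parent v = u := dif_pos rfl

@[simp] theorem attach_parent_coe (v : V) (q : ParentMap {w // w ≠ v}) (u w : {w // w ≠ v}) :
    (attach v q u).parent w = q.parent w := dif_neg w.2

theorem isLeaf_attach (v : V) (q : ParentMap {w // w ≠ v}) (u : {w // w ≠ v}) :
    (attach v q u).IsLeaf v := by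
  intro w
  by_cases hw : w = v
  · subst hw
    simpa using u.2
  · have := attach_parent_coe v q u ⟨w, hw⟩
    rw [this]
    exact (q.parent ⟨w, hw⟩).2

/-- Remove a leaf from a tree. -/
def detach (T : ParentMap V) (v : V) (h : T.IsLeaf v) : ParentMap {w // w ≠ v} where
  root := ⟨T.root, h.root_ne⟩
  parent w := ⟨T.parent w, h w⟩
  parent_root := Subtype.ext T.parent_root
  exists_iterate w := by
    obtain ⟨k, hk⟩ := T.exists_iterate w
    refine ⟨k, Subtype.ext (Eq.trans ?_ hk)⟩
    have : Function.Semiconj Subtype.val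
      (fun w : {w // w ≠ v} => (⟨T.parent w, h w⟩ : {w // w ≠ v})) T.parent := fun _ => rfl
    exact this.iterate_right k w

/-- Trees with a given leaf `v` correspond to a tree on the other vertices and the
parent of `v`. -/
def leafEquiv (v : V) :
    {w // w ≠ v} × ParentMap {w // w ≠ v} ≃ {T : ParentMap V // T.IsLeaf v} where
  toFun x := ⟨attach v x.2 x.1, isLeaf_attach v x.2 x.1⟩
  invFun T := (⟨T.1.parent v, T.2 v⟩, T.1.detach v T.2)
  left_inv x := by
    refine Prod.ext (Subtype.ext (attach_parent_self v x.2 x.1)) (ParentMap.ext rfl ?_)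
    funext w
    exact Subtype.ext (attach_parent_coe v x.2 x.1 w)
  right_inv T := by
    refine Subtype.ext (ParentMap.ext rfl ?_)
    funext w
    by_cases hw : w = v
    · subst hw
      exact attach_parent_self w _ _
    · exact attach_parent_coe v _ _ ⟨w, hw⟩

/-- When only trees with leaf `v` contribute, a sum over trees becomes a sum over the parent of `v`
and the tree on the rest. -/
theorem sum_eq_sum_attach [Fintype V] {M : Type*} [AddCommMonoid M] (v : V) (F : ParentMap V → M)
    (hF : ∀ T : ParentMap V, ¬ T.IsLeaf v → F T = 0) :
    ∑ T, F T = ∑ u, ∑ q, F (attach v q u) := by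
  classical
  rw [← Fintype.sum_prod_type' (f := fun u q => F (attach v q u)),
    ← Finset.sum_filter_of_ne (p := fun T : ParentMap V => T.IsLeaf v)
      (fun T _ hT => not_imp_comm.1 (hF T) hT),
    ← Finset.sum_subtype_eq_sum_filter, Finset.subtype_univ]
  exact (Fintype.sum_equiv (leafEquiv v) _ _ fun _ => rfl).symm

end Attach

/-! ### Weighted sums over type trees -/

section TreeSum

variable {D : Type*} [Fintype D] [DecidableEq D]

/-- The product of `m s t` over the edges from a child `s` to its parent `t`. -/
def weight (m : D → D → ℕ) (A : ParentMap D) : ℕ :=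
  ∏ s, if s = A.root then 1 else m s (A.parent s)

/-- The sum of the weights of the trees with root `ρ`. -/
noncomputable def treeSum (ρ : D) (m : D → D → ℕ) : ℕ :=
  ∑ A : ParentMap D, if A.root = ρ then A.weight m else 0

theorem weight_eq_zero [Nontrivial D] {m : D → D → ℕ} {s : D} (hs : ∀ t, m t s = 0)
    {A : ParentMap D} (hA : ¬ A.IsLeaf s) : A.weight m = 0 := by
  have : ¬ ∀ w, w ≠ A.root → A.parent w ≠ s := fun h => hA (A.isLeaf_of_forall_ne_root h)
  push Not at this
  obtain ⟨w, hw, rfl⟩ := this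
  exact Finset.prod_eq_zero (Finset.mem_univ w) (by rw [if_neg hw, hs])

theorem weight_attach (m : D → D → ℕ) (s : D) (q : ParentMap {t // t ≠ s}) (u : {t // t ≠ s}) :
    (attach s q u).weight m = m s u * q.weight fun x t : {t // t ≠ s} => m x t := by
  rw [weight, Fintype.prod_eq_mul_prod_subtype_ne _ s, attach_root, if_neg q.root.2.symm,
    attach_parent_self, weight]
  simp only [attach_parent_coe, Subtype.coe_inj]

theorem treeSum_eq_zero [Nontrivial D] {m : D → D → ℕ} {ρ : D} (h : ∀ t, m t ρ = 0) :
    treeSum ρ m = 0 := by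
  refine Finset.sum_eq_zero fun A _ => ?_
  split_ifs with hA
  · exact weight_eq_zero h fun hl => hl.root_ne hA
  · rfl

/-- A tree in which `s` has a child has weight zero. In the others `s` is a leaf, and its parent can
be chosen independently of the remaining tree. -/
theorem treeSum_eq_mul [Nontrivial D] {m : D → D → ℕ} {ρ s : D} (hs : ∀ t, m t s = 0)
    (hρ : ρ ≠ s) :
    treeSum ρ m = (∑ t, m s t) * treeSum (⟨ρ, hρ⟩ : {t // t ≠ s}) fun x t : {t // t ≠ s} => m x t := by
  rw [treeSum, sum_eq_sum_attach s _ fun A hA => by rw [weight_eq_zero hs hA, ite_self],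
    Fintype.sum_eq_add_sum_subtype_ne (fun t => m s t) s, hs, zero_add, Finset.sum_mul]
  refine Finset.sum_congr rfl fun u _ => ?_
  rw [treeSum, Finset.mul_sum]
  refine Finset.sum_congr rfl fun q _ => ?_
  rw [attach_root, weight_attach, mul_ite, mul_zero]
  simp only [Subtype.ext_iff]

theorem treeSum_of_subsingleton [Subsingleton D] (ρ : D) (m : D → D → ℕ) : treeSum ρ m = 1 := by
  let A : ParentMap D := ⟨ρ, id, rfl, fun v => ⟨0, Subsingleton.elim _ _⟩⟩
  rw [treeSum, Fintype.sum_eq_single A fun B hB =>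
    absurd (ParentMap.ext (Subsingleton.elim _ _) (Subsingleton.elim _ _)) hB, if_pos rfl]
  exact Finset.prod_eq_one fun s _ => if_pos (Subsingleton.elim _ _)

end TreeSum

end ParentMap

/-! ### Lowering one matrix entry -/

section Dec

variable {α β : Type*} [DecidableEq α] [DecidableEq β]

/-- Lower the value at `(a, b)` by one. -/
def dec (f : α → β → ℕ) (a : α) (b : β) (x : α) (y : β) : ℕ :=
  f x y - if x = a ∧ y = b then 1 else 0

theorem dec_add {f : α → β → ℕ} {a : α} {b : β} (h : 1 ≤ f a b) (x : α) (y : β) :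
    dec f a b x y + (if x = a ∧ y = b then 1 else 0) = f x y := by
  rw [dec]
  split_ifs with hxy
  · rw [hxy.1, hxy.2]
    omega
  · rfl

theorem sum_dec_add [Fintype α] {f : α → β → ℕ} {a : α} {b : β} (h : 1 ≤ f a b) (y : β) :
    ∑ x, dec f a b x y + (if y = b then 1 else 0) = ∑ x, f x y := by
  rw [Finset.sum_congr rfl fun x _ => (dec_add h x y).symm, Finset.sum_add_distrib]
  simp [ite_and]

theorem mul_prod_factorial_dec [Fintype α] [Fintype β] {f : α → β → ℕ} {a : α} {b : β}
    (h : 1 ≤ f a b) :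
    f a b * ∏ x, ∏ y, (dec f a b x y).factorial = ∏ x, ∏ y, (f x y).factorial := by
  have key : ∀ x y, (f x y).factorial =
      (if x = a then if y = b then f a b else 1 else 1) * (dec f a b x y).factorial := by
    intro x y
    rw [dec, ← ite_and]
    split_ifs with hxy
    · rw [hxy.1, hxy.2, Nat.mul_factorial_pred (by omega)]
    · simp
  have h2 : ∀ x, ∏ y, (if x = a then if y = b then f a b else 1 else 1) =
      if x = a then f a b else 1 := by
    intro x
    split_ifs <;> simp
  simp_rw [key, Finset.prod_mul_distrib, h2]
  simp

end Dec

/-- If `s` is not the root of `A`, the weight of `A` has exactly one factor from row `s`, namely `m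
s (A.parent s)`. Lowering the entry `(s, t)` matters only for `t = A.parent s`, and the loss
multiplied by `m s t` is the weight itself. If `s` is the root, nothing is lost. -/
theorem ParentMap.sum_mul_treeSum_dec {D : Type*} [Fintype D] [DecidableEq D] (ρ s : D)
    (m : D → D → ℕ) :
    ∑ t, m s t * treeSum ρ (dec m s t) + (if s = ρ then 0 else treeSum ρ m) =
      (∑ t, m s t) * treeSum ρ m := by
  have key : ∀ A : ParentMap D, ∑ t, m s t * A.weight (dec m s t) +
      (if s = A.root then 0 else A.weight m) = (∑ t, m s t) * A.weight m := by
    intro A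
    have h1 : ∀ m' : D → D → ℕ, A.weight m' = (if s = A.root then 1 else m' s (A.parent s)) *
        ∏ x : {x // x ≠ s}, if (x : D) = A.root then 1 else m' x (A.parent x) :=
      fun m' => Fintype.prod_eq_mul_prod_subtype_ne _ s
    have h2 : ∀ t, ∏ x : {x // x ≠ s}, (if (x : D) = A.root then 1 else dec m s t x (A.parent x)) =
        ∏ x : {x // x ≠ s}, if (x : D) = A.root then 1 else m x (A.parent x) := by
      intro t
      refine Finset.prod_congr rfl fun x _ => ?_
      simp only [dec, x.2, false_and, if_false, Nat.sub_zero]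
    simp_rw [h1, h2]
    generalize ∏ x : {x // x ≠ s}, (if (x : D) = A.root then 1 else m x (A.parent x)) = R
    split_ifs with hs
    · rw [add_zero, Finset.sum_mul]
    · have h3 : ∀ t, m s t * dec m s t s (A.parent s) + (if t = A.parent s then m s t else 0) =
          m s t * m s (A.parent s) := by
        intro t
        rw [dec]
        by_cases ht : t = A.parent s
        · subst ht
          -- At a zero entry the subtraction in `dec` is truncated, but the factor `m s t` vanishes
          -- too.
          rcases Nat.eq_zero_or_pos (m s (A.parent s)) with h0 | h0
          · simp [h0]
          · rw [if_pos ⟨rfl, rfl⟩, if_pos rfl, ← Nat.mul_succ]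
            congr 1
            omega
        · rw [if_neg fun h => ht h.2.symm, if_neg ht]
          rfl
      rw [← mul_assoc, Finset.sum_mul, ← Finset.sum_congr rfl fun t _ => h3 t,
        Finset.sum_add_distrib, add_mul, Finset.sum_mul]
      simp [mul_assoc]
  have h4 : ∀ m', treeSum ρ m' = ∑ A : ParentMap D with A.root = ρ, A.weight m' :=
    fun m' => (Finset.sum_filter _ _).symm
  have h5 : (if s = ρ then 0 else treeSum ρ m) =
      ∑ A : ParentMap D with A.root = ρ, if s = A.root then 0 else A.weight m := by
    split_ifs with hs
    · exact (Finset.sum_eq_zero fun A hA => if_pos (hs.trans (Finset.mem_filter.1 hA).2.symm)).symm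
    · rw [h4]
      exact Finset.sum_congr rfl fun A hA =>
        (if_neg fun h => hs (h.trans (Finset.mem_filter.1 hA).2)).symm
  rw [h5]
  simp_rw [h4, Finset.mul_sum]
  rw [Finset.sum_comm, ← Finset.sum_add_distrib]
  exact Finset.sum_congr rfl fun A _ => key A


open ParentMap

/-! ### Trees with prescribed indegrees at each vertex -/

section Count

variable {V D : Type*} [Fintype V] [DecidableEq D]

/-- The number of vertices of type `t`. -/
def typeCard (τ : V → D) (t : D) : ℕ := ∑ v, if τ v = t then 1 else 0

/-- The number of edges from type `s` to type `t` prescribed by the indegrees `c`. -/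
def edgeSum (τ : V → D) (c : V → D → ℕ) (s t : D) : ℕ := ∑ v, if τ v = t then c v s else 0

theorem sum_edgeSum [Fintype D] (τ : V → D) (c : V → D → ℕ) (s : D) :
    ∑ t, edgeSum τ c s t = ∑ v, c v s := by
  simp_rw [edgeSum]
  rw [Finset.sum_comm]
  simp

theorem sum_typeCard [Fintype D] (τ : V → D) : ∑ t, typeCard τ t = Fintype.card V := by
  simp_rw [typeCard]
  rw [Finset.sum_comm]
  simp

theorem typeCard_pos {τ : V → D} (hτ : Function.Surjective τ) (t : D) : 0 < typeCard τ t := by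
  obtain ⟨v, rfl⟩ := hτ t
  exact Finset.sum_pos' (fun _ _ => Nat.zero_le _) ⟨v, Finset.mem_univ v, by simp⟩

theorem sum_mul_eq_sum_edgeSum_mul [Fintype D] (τ : V → D) (c : V → D → ℕ) (s : D) (g : D → ℕ) :
    ∑ u, c u s * g (τ u) = ∑ t, edgeSum τ c s t * g t := by
  simp_rw [edgeSum, Finset.sum_mul]
  rw [Finset.sum_comm]
  simp [ite_mul]

variable [DecidableEq V]

theorem edgeSum_dec {τ : V → D} {c : V → D → ℕ} {u : V} {s : D} (h : 1 ≤ c u s) :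
    edgeSum τ (dec c u s) = dec (edgeSum τ c) s (τ u) := by
  funext x t
  have h1 : ∀ w, (if τ w = t then c w x else 0) = (if τ w = t then dec c u s w x else 0) +
      if w = u then (if x = s ∧ t = τ u then 1 else 0) else 0 := by
    intro w
    rw [← dec_add h w x]
    by_cases hw : w = u
    · subst hw
      by_cases ht : τ w = t
      · simp [ht]
      · simp [ht, Ne.symm ht]
    · simp [hw]
  have h2 : edgeSum τ c x t = edgeSum τ (dec c u s) x t + if x = s ∧ t = τ u then 1 else 0 := by
    rw [edgeSum, Finset.sum_congr rfl fun w _ => h1 w, Finset.sum_add_distrib]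
    simp [edgeSum]
  rw [dec, h2, Nat.add_sub_cancel]

theorem edgeSum_eq_subtype {τ : V → D} {c : V → D → ℕ} {v : V} (hv : ∀ s, c v s = 0) :
    edgeSum τ c = edgeSum (fun w : {w // w ≠ v} => τ w) (fun w : {w // w ≠ v} => c w) := by
  funext s t
  rw [edgeSum, Fintype.sum_eq_add_sum_subtype_ne _ v, hv, ite_self, zero_add, edgeSum]

/-- The number of children of type `s` of the vertex `u`. -/
def ParentMap.children (T : ParentMap V) (τ : V → D) (u : V) (s : D) : ℕ :=
  ∑ w, if w ≠ T.root ∧ T.parent w = u ∧ τ w = s then 1 else 0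

/-- The number of trees with root of type `ρ` in which every vertex `u` has `c u s` children
of type `s`. -/
noncomputable def treeCount [Fintype D] (τ : V → D) (ρ : D) (c : V → D → ℕ) : ℕ :=
  ∑ T : ParentMap V, if τ T.root = ρ ∧ ∀ u s, T.children τ u s = c u s then 1 else 0

theorem typeCard_eq_add (τ : V → D) (v : V) (t : D) :
    typeCard τ t = (if τ v = t then 1 else 0) + typeCard (fun w : {w // w ≠ v} => τ w) t :=
  Fintype.sum_eq_add_sum_subtype_ne _ v

/-- Every non-root vertex of type `s` is counted at its parent alone. -/
theorem ParentMap.sum_children (T : ParentMap V) (τ : V → D) (s : D) :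
    (if s = τ T.root then 1 else 0) + ∑ u, T.children τ u s = typeCard τ s := by
  have h : ∀ w, ∑ u, (if w ≠ T.root ∧ T.parent w = u ∧ τ w = s then 1 else 0) =
      if w ≠ T.root ∧ τ w = s then 1 else 0 := by
    intro w
    rw [Finset.sum_eq_single (T.parent w)]
    · simp
    · intro u _ hu
      rw [if_neg fun h => hu h.2.1.symm]
    · simp
  simp_rw [children]
  rw [Finset.sum_comm, Finset.sum_congr rfl fun w _ => h w, typeCard,
    Fintype.sum_eq_add_sum_subtype_ne _ T.root, Fintype.sum_eq_add_sum_subtype_ne _ T.root]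
  simp only [ne_eq, not_true_eq_false, false_and, if_false, zero_add, eq_comm (a := s)]
  exact congrArg _ (Finset.sum_congr rfl fun w _ => by simp [w.2])

theorem ParentMap.isLeaf_of_children [Nontrivial V] (T : ParentMap V) {τ : V → D} {v : V}
    (h : ∀ s, T.children τ v s = 0) : T.IsLeaf v := by
  refine T.isLeaf_of_forall_ne_root fun w hw hp => ?_
  have := Finset.sum_eq_zero_iff.1 (h (τ w)) w (Finset.mem_univ w)
  simp [hw, hp] at this

theorem children_attach_self (τ : V → D) (v : V) (q : ParentMap {w // w ≠ v})
    (u : {w // w ≠ v}) (s : D) : (attach v q u).children τ v s = 0 :=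
  Finset.sum_eq_zero fun w _ => if_neg fun h => isLeaf_attach v q u w h.2.1

theorem children_attach_coe (τ : V → D) (v : V) (q : ParentMap {w // w ≠ v})
    (u x : {w // w ≠ v}) (s : D) : (attach v q u).children τ x s =
      q.children (fun w : {w // w ≠ v} => τ w) x s + if x = u ∧ s = τ v then 1 else 0 := by
  rw [children, Fintype.sum_eq_add_sum_subtype_ne _ v, add_comm, children]
  congr 1
  · simp only [attach_root, attach_parent_coe, ne_eq, Subtype.coe_inj]
  · simp only [attach_root, attach_parent_self, Subtype.coe_inj]
    have := q.root.2.symm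
    simp [this, eq_comm]

variable [Fintype D]

/-- The childless vertex `v` is a leaf; detaching it costs its parent one child of type `τ v`. -/
theorem treeCount_eq_sum [Nontrivial V] {τ : V → D} {c : V → D → ℕ} {v : V} (hv : ∀ s, c v s = 0)
    (ρ : D) :
    treeCount τ ρ c = ∑ u : {w // w ≠ v}, if 1 ≤ c u (τ v) then
      treeCount (fun w : {w // w ≠ v} => τ w) ρ (dec (fun w : {w // w ≠ v} => c w) u (τ v))
      else 0 := by
  rw [treeCount, sum_eq_sum_attach v]
  · refine Finset.sum_congr rfl fun u _ => ?_
    have h : ∀ q : ParentMap {w // w ≠ v},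
        (∀ x s, (attach v q u).children τ x s = c x s) ↔ 1 ≤ c u (τ v) ∧
        ∀ x s, q.children (fun w : {w // w ≠ v} => τ w) x s =
          dec (fun w : {w // w ≠ v} => c w) u (τ v) x s := by
      intro q
      constructor
      · intro h
        have h1 : ∀ (x : {w // w ≠ v}) s, q.children (fun w : {w // w ≠ v} => τ w) x s +
            (if x = u ∧ s = τ v then 1 else 0) = c x s :=
          fun x s => (children_attach_coe τ v q u x s).symm.trans (h x s)
        refine ⟨by rw [← h1, if_pos ⟨rfl, rfl⟩]; omega, fun x s => ?_⟩
        rw [dec, ← h1 x s, Nat.add_sub_cancel]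
      · rintro ⟨h1, h2⟩ x s
        by_cases hx : x = v
        · subst hx
          rw [hv, children_attach_self]
        · rw [children_attach_coe τ v q u ⟨x, hx⟩ s, h2]
          exact dec_add (f := fun w : {w // w ≠ v} => c w) h1 ⟨x, hx⟩ s
    simp_rw [h, treeCount]
    by_cases h1 : 1 ≤ c u (τ v) <;> simp [h1]
  · intro T hT
    exact if_neg fun h => hT (T.isLeaf_of_children fun s => (h.2 v s).trans (hv s))

end Count

/-! ### The formula for prescribed indegrees -/

theorem treeCount_mul_prod_factorial_of_subsingleton {V D : Type*} [Fintype V] [DecidableEq V]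
    [Fintype D] [DecidableEq D] [Subsingleton V] {τ : V → D} (hτ : Function.Surjective τ) (ρ : D)
    (c : V → D → ℕ)
    (h : ∀ s, typeCard τ s = (if s = ρ then 1 else 0) + ∑ v, c v s) :
    treeCount τ ρ c * ∏ v, ∏ s, (c v s).factorial =
      (∏ t, (typeCard τ t - 1).factorial) * treeSum ρ (edgeSum τ c) := by
  have hD : Subsingleton D := hτ.subsingleton
  obtain ⟨v, rfl⟩ := hτ ρ
  have h1 : ∀ t, typeCard τ t = 1 := by
    intro t
    rw [typeCard, Fintype.sum_eq_single v fun w hw => absurd (Subsingleton.elim _ _) hw,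
      if_pos (Subsingleton.elim _ _)]
  have h0 : ∀ w s, c w s = 0 := by
    intro w s
    have := h s
    rw [h1, if_pos (Subsingleton.elim _ _), eq_comm, Nat.add_eq_left] at this
    exact Finset.sum_eq_zero_iff.1 this w (Finset.mem_univ w)
  have h2 : treeCount τ (τ v) c = 1 := by
    let A : ParentMap V := ⟨v, id, rfl, fun v => ⟨0, Subsingleton.elim _ _⟩⟩
    rw [treeCount, Fintype.sum_eq_single A fun B hB =>
      absurd (ParentMap.ext (Subsingleton.elim _ _) (Subsingleton.elim _ _)) hB, if_pos]
    refine ⟨rfl, fun u s => ?_⟩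
    rw [h0]
    exact Finset.sum_eq_zero fun w _ => if_neg fun h => h.1 (Subsingleton.elim _ _)
  rw [h2, treeSum_of_subsingleton]
  simp [h0, h1]

/-- The indegree of each vertex being prescribed, remove a childless vertex which is not the
only one of its type. -/
theorem treeCount_mul_prod_factorial_of_one_lt {V D : Type*} [Fintype V] [DecidableEq V]
    [Fintype D] [DecidableEq D] [Nontrivial V] {τ : V → D} (hτ : Function.Surjective τ) (ρ : D)
    (c : V → D → ℕ)
    (h : ∀ s, typeCard τ s = (if s = ρ then 1 else 0) + ∑ v, c v s)
    {v : V} (hv : ∀ s, c v s = 0) (h1 : 1 < typeCard τ (τ v))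
    (ih : ∀ c' : {w // w ≠ v} → D → ℕ, Function.Surjective (fun w : {w // w ≠ v} => τ w) →
      (∀ s, typeCard (fun w : {w // w ≠ v} => τ w) s =
        (if s = ρ then 1 else 0) + ∑ w, c' w s) →
      treeCount (fun w : {w // w ≠ v} => τ w) ρ c' * ∏ w, ∏ s, (c' w s).factorial =
        (∏ t, (typeCard (fun w : {w // w ≠ v} => τ w) t - 1).factorial) *
          treeSum ρ (edgeSum (fun w : {w // w ≠ v} => τ w) c')) :
    treeCount τ ρ c * ∏ v, ∏ s, (c v s).factorial =
      (∏ t, (typeCard τ t - 1).factorial) * treeSum ρ (edgeSum τ c) := by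
  have hpos : ∀ t, 0 < typeCard (fun w : {w // w ≠ v} => τ w) t := by
    intro t
    have h2 := typeCard_eq_add τ v t
    have h3 := typeCard_pos hτ t
    split_ifs at h2 with ht
    · subst ht
      omega
    · omega
  have hsurj : Function.Surjective (fun w : {w // w ≠ v} => τ w) := by
    intro t
    by_contra hne
    push Not at hne
    exact (hpos t).ne' (Finset.sum_eq_zero fun w _ => if_neg (hne w))
  set s := τ v with hs
  -- The trees in which `v` hangs from `u`: the factor `c u s` restores `(c u s)!` from the lowered
  -- factorial.
  have hdec : ∀ u : {w // w ≠ v}, (if 1 ≤ c u s then treeCount (fun w : {w // w ≠ v} => τ w) ρ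
      (dec (fun w : {w // w ≠ v} => c w) u s) else 0) * ∏ v, ∏ s, (c v s).factorial =
      (∏ t, (typeCard (fun w : {w // w ≠ v} => τ w) t - 1).factorial) *
        (c u s * treeSum ρ (dec (edgeSum τ c) s (τ u))) := by
    intro u
    split_ifs with hu
    · have hu' : 1 ≤ (fun w : {w // w ≠ v} => c w) u s := hu
      have h2 := ih (dec (fun w : {w // w ≠ v} => c w) u s) hsurj (by
        intro t
        have h3 := sum_dec_add (f := fun w : {w // w ≠ v} => c w) hu' t
        have h4 := Fintype.sum_eq_add_sum_subtype_ne (fun w => c w t) v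
        have h5 := typeCard_eq_add τ v t
        have h6 := h t
        simp only [hv, ← hs, eq_comm (a := s)] at h3 h4 h5
        omega)
      rw [edgeSum_dec (c := fun w : {w // w ≠ v} => c w) hu', ← edgeSum_eq_subtype hv] at h2
      rw [Fintype.prod_eq_mul_prod_subtype_ne _ v]
      simp only [hv, Nat.factorial_zero, Finset.prod_const_one, one_mul]
      rw [← mul_prod_factorial_dec (f := fun w : {w // w ≠ v} => c w) hu', mul_left_comm, h2,
        mul_left_comm]
    · have : c u s = 0 := by omega
      simp [this]
  rw [treeCount_eq_sum hv, Finset.sum_mul, Finset.sum_congr rfl fun u _ => hdec u,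
    ← Finset.mul_sum]
  -- Grouping the parents `u` by type gives the left side of `sum_mul_treeSum_dec`. Both cases yield
  -- `n_s - 1`: for `s = ρ` the row sum is already `n_s - 1`, otherwise it is `n_s` and one tree sum
  -- is subtracted.
  have h7 : ∑ u : {w // w ≠ v}, c u s * treeSum ρ (dec (edgeSum τ c) s (τ u)) =
      (typeCard τ s - 1) * treeSum ρ (edgeSum τ c) := by
    have h8 := sum_mul_eq_sum_edgeSum_mul τ c s fun t => treeSum ρ (dec (edgeSum τ c) s t)
    rw [Fintype.sum_eq_add_sum_subtype_ne _ v, hv, zero_mul, zero_add] at h8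
    have h9 := sum_mul_treeSum_dec ρ s (edgeSum τ c)
    rw [sum_edgeSum] at h9
    have h10 := h s
    rw [h8, Nat.sub_mul, one_mul]
    split_ifs at h9 h10
    · rw [h10, add_mul, ← h9]
      omega
    · rw [h10, zero_add, ← h9]
      omega
  rw [h7, ← mul_assoc, mul_comm (∏ t, _)]
  congr 1
  rw [Fintype.prod_eq_mul_prod_subtype_ne _ s, Fintype.prod_eq_mul_prod_subtype_ne _ s, ← mul_assoc]
  have h11 := typeCard_eq_add τ v s
  rw [if_pos hs.symm] at h11
  congr 1
  · rw [← Nat.mul_factorial_pred (n := typeCard τ s - 1) (by omega)]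
    congr 2
    omega
  · refine Finset.prod_congr rfl fun t _ => ?_
    rw [typeCard_eq_add τ v t, if_neg fun h => t.2 (hs.trans h).symm, zero_add]

theorem treeCount_subtype {V D : Type*} [Fintype V] [DecidableEq V] [Fintype D] [DecidableEq D]
    {s : D} (τ : V → {t // t ≠ s}) (ρ : {t // t ≠ s}) (c : V → D → ℕ) (hc : ∀ v, c v s = 0) :
    treeCount (fun v => (τ v : D)) ρ c = treeCount τ ρ fun v (t : {t // t ≠ s}) => c v t := by
  refine Finset.sum_congr rfl fun T _ => if_congr (and_congr Subtype.coe_inj ?_) rfl rfl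
  have h : ∀ u (t : {t // t ≠ s}), T.children (fun v => (τ v : D)) u t = T.children τ u t := by
    intro u t
    simp only [children, Subtype.coe_inj]
  refine ⟨fun hT u t => (h u t).symm.trans (hT u t), fun hT u t => ?_⟩
  by_cases ht : t = s
  · subst ht
    rw [hc]
    exact Finset.sum_eq_zero fun w _ => if_neg fun hw => (τ w).2 hw.2.2
  · exact (h u ⟨t, ht⟩).trans (hT u ⟨t, ht⟩)

/-- The indegree of each vertex being prescribed, remove a childless vertex together with its
type if this vertex is the only one of its type. -/
theorem treeCount_mul_prod_factorial_of_eq_one {V D : Type*} [Fintype V] [DecidableEq V]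
    [Fintype D] [DecidableEq D] [Nontrivial V] {τ : V → D} (hτ : Function.Surjective τ) (ρ : D)
    (c : V → D → ℕ)
    (h : ∀ s, typeCard τ s = (if s = ρ then 1 else 0) + ∑ v, c v s)
    {v : V} (hv : ∀ s, c v s = 0) (h1 : typeCard τ (τ v) = 1) (hρ : ρ ≠ τ v)
    (hτ' : ∀ w : {w // w ≠ v}, τ w ≠ τ v)
    (ih : ∀ c' : {w // w ≠ v} → {t // t ≠ τ v} → ℕ,
      Function.Surjective (fun w : {w // w ≠ v} => (⟨τ w, hτ' w⟩ : {t // t ≠ τ v})) →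
      (∀ s, typeCard (fun w : {w // w ≠ v} => (⟨τ w, hτ' w⟩ : {t // t ≠ τ v})) s =
        (if s = ⟨ρ, hρ⟩ then 1 else 0) + ∑ w, c' w s) →
      treeCount (fun w : {w // w ≠ v} => (⟨τ w, hτ' w⟩ : {t // t ≠ τ v})) ⟨ρ, hρ⟩ c' *
          ∏ w, ∏ s, (c' w s).factorial =
        (∏ t, (typeCard (fun w : {w // w ≠ v} => (⟨τ w, hτ' w⟩ : {t // t ≠ τ v})) t
          - 1).factorial) *
        treeSum ⟨ρ, hρ⟩
          (edgeSum (fun w : {w // w ≠ v} => (⟨τ w, hτ' w⟩ : {t // t ≠ τ v})) c')) :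
    treeCount τ ρ c * ∏ v, ∏ s, (c v s).factorial =
      (∏ t, (typeCard τ t - 1).factorial) * treeSum ρ (edgeSum τ c) := by
  set s := τ v with hs
  set τ' : {w // w ≠ v} → {t // t ≠ s} := fun w => ⟨τ w, hτ' w⟩ with hτ'_def
  -- The only vertex of type `s` is not the root, so exactly one child of type `s` is prescribed, at
  -- a single vertex `u`.
  have hsum : ∑ w : {w // w ≠ v}, c w s = 1 := by
    have h2 := h s
    have h3 := Fintype.sum_eq_add_sum_subtype_ne (fun w => c w s) v
    simp only [hv] at h3
    rw [h1, if_neg hρ.symm] at h2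
    omega
  obtain ⟨u, -, hu⟩ : ∃ u ∈ (Finset.univ : Finset {w // w ≠ v}), c u s ≠ 0 :=
    Finset.exists_ne_zero_of_sum_ne_zero (by omega)
  have hu0 : ∀ w : {w // w ≠ v}, c w s = if w = u then 1 else 0 := by
    have h2 := Fintype.sum_eq_add_sum_subtype_ne (fun w : {w // w ≠ v} => c w s) u
    intro w
    split_ifs with hw
    · subst hw
      omega
    · by_contra h3
      have h4 : c w s ≤ ∑ x : {x // x ≠ u}, c x s :=
        Finset.single_le_sum (f := fun x : {x // x ≠ u} => c x s) (fun _ _ => Nat.zero_le _)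
          (Finset.mem_univ ⟨w, hw⟩)
      omega
  have hcount : treeCount τ ρ c =
      treeCount τ' ⟨ρ, hρ⟩ fun w (t : {t // t ≠ s}) => c w t := by
    rw [treeCount_eq_sum hv, Fintype.sum_eq_single u, if_pos (Nat.one_le_iff_ne_zero.2 hu)]
    · refine (treeCount_subtype τ' ⟨ρ, hρ⟩ (dec (fun w : {w // w ≠ v} => c w) u s) ?_).trans ?_
      · intro w
        simp only [dec, hu0]
        by_cases hw : w = u <;> simp [hw]
      · congr 1
        funext w t
        rw [dec, if_neg fun h => t.2 h.2, Nat.sub_zero]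
    · intro w hw
      rw [← hs, hu0, if_neg hw]
      rfl
  have hedge : ∀ x t : {t // t ≠ s}, edgeSum τ c x t =
      edgeSum τ' (fun w (t : {t // t ≠ s}) => c w t) x t := by
    intro x t
    rw [edgeSum_eq_subtype hv, edgeSum, edgeSum]
    simp only [hτ'_def, Subtype.ext_iff]
  have htype : ∀ t : {t // t ≠ s}, typeCard τ t = typeCard τ' t := by
    intro t
    rw [typeCard_eq_add τ v, if_neg t.2.symm, zero_add, typeCard, typeCard]
    simp only [hτ'_def, Subtype.ext_iff]
  have hsurj : Function.Surjective τ' := by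
    rintro ⟨t, ht⟩
    obtain ⟨w, rfl⟩ := hτ t
    exact ⟨⟨w, fun hw => ht (hw ▸ rfl)⟩, rfl⟩
  have key := ih (fun w t => c w t) hsurj (by
    intro t
    have h2 := Fintype.sum_eq_add_sum_subtype_ne (fun w => c w t) v
    rw [hv, zero_add] at h2
    rw [← htype, h, h2]
    simp only [Subtype.ext_iff])
  have hcol : ∀ t, edgeSum τ c t s = 0 := by
    intro t
    rw [edgeSum, Fintype.sum_eq_add_sum_subtype_ne _ v, hv, ite_self, zero_add]
    exact Finset.sum_eq_zero fun w _ => if_neg (hτ' w)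
  have hD : Nontrivial D := ⟨⟨ρ, s, hρ⟩⟩
  have hrow : ∑ t, edgeSum τ c s t = 1 := by
    rw [sum_edgeSum, Fintype.sum_eq_add_sum_subtype_ne _ v, hv, hsum]
  have hprod : ∏ v, ∏ s, (c v s).factorial =
      ∏ w : {w // w ≠ v}, ∏ t : {t // t ≠ s}, (c w t).factorial := by
    rw [Fintype.prod_eq_mul_prod_subtype_ne _ v]
    simp only [hv, Nat.factorial_zero, Finset.prod_const_one, one_mul]
    refine Finset.prod_congr rfl fun w _ => ?_
    rw [Fintype.prod_eq_mul_prod_subtype_ne _ s, hu0]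
    split_ifs <;> simp
  rw [treeSum_eq_mul hcol hρ, hrow, one_mul, hcount, hprod, key,
    Fintype.prod_eq_mul_prod_subtype_ne (fun t => (typeCard τ t - 1).factorial) s, h1]
  simp only [htype, hedge, Nat.sub_self, Nat.factorial_zero, one_mul]
  rfl

theorem treeCount_mul_prod_factorial {V D : Type*} [Fintype V] [DecidableEq V]
    [Fintype D] [DecidableEq D] {τ : V → D} (hτ : Function.Surjective τ) (ρ : D)
    (c : V → D → ℕ)
    (h : ∀ s, typeCard τ s = (if s = ρ then 1 else 0) + ∑ v, c v s) :
    treeCount τ ρ c * ∏ v, ∏ s, (c v s).factorial =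
      (∏ t, (typeCard τ t - 1).factorial) * treeSum ρ (edgeSum τ c) := by
  classical
  induction hk : Fintype.card V generalizing V D with
  | zero =>
    obtain ⟨v, -⟩ := hτ ρ
    exact absurd hk (Fintype.card_pos_iff.2 ⟨v⟩).ne'
  | succ k ih =>
    rcases subsingleton_or_nontrivial V with hV | hV
    · exact treeCount_mul_prod_factorial_of_subsingleton hτ ρ c h
    -- The prescribed indegrees add up to `|V| - 1`, so they cannot all be nonzero.
    obtain ⟨v, hv⟩ : ∃ v, ∀ s, c v s = 0 := by
      by_contra hne
      push Not at hne
      have h1 : Fintype.card V = 1 + ∑ v, ∑ s, c v s := by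
        rw [Finset.sum_comm, ← sum_typeCard τ, Finset.sum_congr rfl fun s _ => h s,
          Finset.sum_add_distrib]
        simp
      have h2 : ∑ v : V, 1 ≤ ∑ v, ∑ s, c v s := by
        refine Finset.sum_le_sum fun v _ => ?_
        obtain ⟨s, hs⟩ := hne v
        exact (Nat.one_le_iff_ne_zero.2 hs).trans
          (Finset.single_le_sum (fun _ _ => Nat.zero_le _) (Finset.mem_univ s))
      simp only [Finset.sum_const, Finset.card_univ, smul_eq_mul, mul_one] at h2
      omega
    have hk' : Fintype.card {w // w ≠ v} = k := by
      rw [Fintype.card_subtype_compl, Fintype.card_subtype_eq]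
      omega
    -- Surjectivity of `τ` must survive the removal of `v`, so a type with a single vertex is
    -- removed along with it.
    rcases (Nat.succ_le_of_lt (typeCard_pos hτ (τ v))).lt_or_eq with h1 | h1
    · exact treeCount_mul_prod_factorial_of_one_lt hτ ρ c h hv h1
        fun c' hτ' hc' => ih hτ' ρ c' hc' hk'
    · have hτ' : ∀ w : {w // w ≠ v}, τ w ≠ τ v := by
        intro w hw
        have h2 := typeCard_eq_add τ v (τ v)
        have h3 : 1 ≤ typeCard (fun w : {w // w ≠ v} => τ w) (τ v) := by
          have := Finset.single_le_sum (f := fun w : {w // w ≠ v} => if τ w = τ v then 1 else 0)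
            (fun _ _ => Nat.zero_le _) (Finset.mem_univ w)
          rwa [if_pos hw] at this
        rw [if_pos rfl] at h2
        omega
      -- If `v` is the only vertex of root type, it would be a childless root beside other vertices;
      -- both sides are zero.
      by_cases hρ : ρ = τ v
      · subst hρ
        obtain ⟨w, hw⟩ := exists_ne v
        have hD : Nontrivial D := ⟨⟨_, _, hτ' ⟨w, hw⟩⟩⟩
        have hcol : ∀ t, edgeSum τ c t (τ v) = 0 := by
          intro t
          rw [edgeSum, Fintype.sum_eq_add_sum_subtype_ne _ v, hv, ite_self, zero_add]
          exact Finset.sum_eq_zero fun w _ => if_neg (hτ' w)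
        rw [treeSum_eq_zero hcol, mul_zero, treeCount, Finset.sum_eq_zero, zero_mul]
        intro T _
        refine if_neg fun hT => ?_
        have hl := (T.isLeaf_of_children fun s => (hT.2 v s).trans (hv s)).root_ne
        exact hτ' ⟨T.root, hl⟩ hT.1
      · exact treeCount_mul_prod_factorial_of_eq_one hτ ρ c h hv h1.symm hρ hτ'
          fun c' hτ' hc' => ih hτ' _ c' hc' hk'


/-! ### Distributing indegree types over the vertices -/

/-- The number of functions with prescribed fibre sizes is a multinomial coefficient. -/
theorem card_functions_mul_prod_factorial {α β : Type*} [Fintype α] [DecidableEq α] [Fintype β]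
    [DecidableEq β] (k : β → ℕ) (h : Fintype.card α = ∑ b, k b) :
    Fintype.card {f : α → β // ∀ b, Fintype.card {a // f a = b} = k b} * ∏ b, (k b).factorial =
      (Fintype.card α).factorial := by
  obtain ⟨e⟩ : Nonempty (α ≃ Σ b, Fin (k b)) := ⟨Fintype.equivOfCardEq (by simp [h])⟩
  let f₀ : α → β := fun a => (e a).1
  have hf₀ : ∀ b, Fintype.card {a // f₀ a = b} = k b := by
    intro b
    rw [Fintype.card_congr ((e.subtypeEquiv fun _ => Iff.rfl).trans (Equiv.sigmaSubtype b)),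
      Fintype.card_fin]
  let φ : Equiv.Perm α → {f : α → β // ∀ b, Fintype.card {a // f a = b} = k b} :=
    fun g => ⟨f₀ ∘ g, fun b => (Fintype.card_congr (g.subtypeEquiv fun _ => Iff.rfl)).trans (hf₀ b)⟩
  -- Permutations act transitively on such functions; each fibre of `φ` is a coset of the stabilizer
  -- of `f₀`, of order `∏ (k b)!`.
  have hφ : ∀ f, Fintype.card {g // φ g = f} = ∏ b, (k b).factorial := by
    rintro ⟨f, hf⟩
    let σ : Equiv.Perm α :=
      Equiv.ofFiberEquiv fun b => Fintype.equivOfCardEq ((hf b).trans (hf₀ b).symm)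
    have hσ : ∀ a, f₀ (σ a) = f a := fun a => Equiv.ofFiberEquiv_map _ a
    simp_rw [← hf₀]
    rw [← DomMulAct.stabilizer_card f₀]
    refine Fintype.card_congr ((Equiv.mulRight σ⁻¹).subtypeEquiv fun g => ?_)
    simp only [φ, Subtype.mk.injEq, funext_iff, Function.comp_apply, Equiv.coe_mulRight,
      Equiv.Perm.mul_apply]
    refine ⟨fun H a => ?_, fun H a => ?_⟩
    · rw [H, ← hσ, show σ (σ⁻¹ a) = a from σ.apply_symm_apply a]
    · have := H (σ a)
      rwa [show σ⁻¹ (σ a) = a from σ.symm_apply_apply a, hσ] at this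
  rw [← Fintype.card_perm, ← Fintype.card_congr (Equiv.sigmaFiberEquiv φ), Fintype.card_sigma,
    Finset.sum_congr rfl fun f _ => hφ f, Finset.sum_const, smul_eq_mul, Finset.card_univ]

section Assignments

variable {d : ℕ} {n : Fin d → ℕ}

/-- Assignments of indegree types to the vertices such that `N t c` vertices of type `t`
receive `c`. -/
def IsAssignment (N : Fin d → IndegreeType n → ℕ) (κ : Vertex n → IndegreeType n) : Prop :=
  ∀ t c, Fintype.card {i // κ ⟨t, i⟩ = c} = N t c

instance (N : Fin d → IndegreeType n → ℕ) : DecidablePred (IsAssignment N) :=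
  fun κ => inferInstanceAs (Decidable (∀ t c, Fintype.card {i // κ ⟨t, i⟩ = c} = N t c))

theorem card_isAssignment {N : Fin d → IndegreeType n → ℕ}
    (hN : ∀ t, n t = ∑ c : IndegreeType n, N t c) :
    Fintype.card {κ // IsAssignment N κ} * ∏ t, ∏ c, (N t c).factorial =
      ∏ t, (n t).factorial := by
  have e : {κ // IsAssignment N κ} ≃ ∀ t, {f : Fin (n t) → IndegreeType n //
      ∀ c, Fintype.card {i // f i = c} = N t c} :=
    ((Equiv.piCurry fun (t : Fin d) (_ : Fin (n t)) => IndegreeType n).subtypeEquiv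
      (q := fun f => ∀ t, ∀ c, Fintype.card {i // f t i = c} = N t c)
      fun _ => Iff.rfl).trans
      (Equiv.subtypePiEquivPi (p := fun t (f : Fin (n t) → IndegreeType n) =>
        ∀ c, Fintype.card {i // f i = c} = N t c))
  rw [Fintype.card_congr e, Fintype.card_pi, ← Finset.prod_mul_distrib]
  refine Finset.prod_congr rfl fun t _ => ?_
  have := card_functions_mul_prod_factorial (α := Fin (n t)) (N t)
    ((Fintype.card_fin _).trans (hN t))
  rwa [Fintype.card_fin] at this

theorem typeCard_fst (t : Fin d) : typeCard (Sigma.fst : Vertex n → Fin d) t = n t := by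
  rw [typeCard, Fintype.sum_sigma, Fintype.sum_eq_single t fun t' ht => by simp [ht]]
  simp

theorem IsAssignment.edgeSum_eq {N : Fin d → IndegreeType n → ℕ} {κ : Vertex n → IndegreeType n}
    (h : IsAssignment N κ) (s t : Fin d) :
    edgeSum Sigma.fst (fun v s => (κ v s : ℕ)) s t = edgeCount N s t := by
  rw [edgeSum, Fintype.sum_sigma, Fintype.sum_eq_single t fun t' ht => by simp [ht], edgeCount,
    ← Finset.sum_fiberwise _ fun i => κ ⟨t, i⟩]
  refine Finset.sum_congr rfl fun c _ => ?_
  rw [← h t c, Fintype.card_subtype, mul_comm, ← smul_eq_mul, ← Finset.sum_const]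
  refine Finset.sum_congr rfl fun i hi => ?_
  rw [if_pos rfl, (Finset.mem_filter.1 hi).2]

/-- Both sides multiply `(c s)! ^ N t c` over all triples `(s, t, c)`; the left side groups them by
the value of `c s`. -/
theorem finprod_factorial_pow_indegreeCount (N : Fin d → IndegreeType n → ℕ) :
    ∏ᶠ k : ℕ, k.factorial ^ indegreeCount N k =
      ∏ t, ∏ c : IndegreeType n, ∏ s, (c s : ℕ).factorial ^ N t c := by
  let g : Fin d × Fin d × IndegreeType n → ℕ := fun p => p.2.2 p.1
  have h : ∀ k, k.factorial ^ indegreeCount N k =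
      ∏ p with g p = k, (g p).factorial ^ N p.2.1 p.2.2 := by
    intro k
    rw [Finset.prod_congr rfl fun p hp => by rw [(Finset.mem_filter.1 hp).2],
      Finset.prod_pow_eq_pow_sum, indegreeCount]
    congr 1
    simp only [Finset.sum_filter, Fintype.sum_prod_type, g]
  rw [finprod_eq_prod_of_mulSupport_subset (s := Finset.univ.image g), Finset.prod_congr rfl
    fun k _ => h k, Finset.prod_fiberwise_of_maps_to fun p hp => Finset.mem_image_of_mem g hp]
  · simp only [Fintype.prod_prod_type, g]
    rw [Finset.prod_comm]
    exact Finset.prod_congr rfl fun t _ => Finset.prod_comm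
  · intro k hk
    by_contra hne
    refine hk ((h k).trans (Finset.prod_eq_one fun p hp => ?_))
    exact absurd (by simpa using ⟨_, _, _, (Finset.mem_filter.1 hp).2⟩) hne

theorem IsAssignment.prod_factorial_eq {N : Fin d → IndegreeType n → ℕ}
    {κ : Vertex n → IndegreeType n} (h : IsAssignment N κ) :
    ∏ v, ∏ s, (κ v s : ℕ).factorial = ∏ᶠ k : ℕ, k.factorial ^ indegreeCount N k := by
  rw [finprod_factorial_pow_indegreeCount, Fintype.prod_sigma]
  refine Finset.prod_congr rfl fun t _ => ?_
  rw [← Finset.prod_fiberwise _ fun i => κ ⟨t, i⟩]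
  refine Finset.prod_congr rfl fun c _ => ?_
  rw [Finset.prod_pow, ← h t c, Fintype.card_subtype, ← Finset.prod_const]
  refine Finset.prod_congr rfl fun i hi => ?_
  rw [(Finset.mem_filter.1 hi).2]

theorem IsAssignment.sum_eq {N : Fin d → IndegreeType n → ℕ}
    {κ : Vertex n → IndegreeType n} (h : IsAssignment N κ) (s : Fin d) :
    ∑ v, (κ v s : ℕ) = ∑ t, edgeCount N s t := by
  rw [← sum_edgeSum Sigma.fst (fun v s => (κ v s : ℕ)) s]
  exact Finset.sum_congr rfl fun t _ => h.edgeSum_eq s t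

theorem IsAssignment.treeCount_mul {N : Fin d → IndegreeType n → ℕ}
    {κ : Vertex n → IndegreeType n} (h : IsAssignment N κ) (hn : ∀ t, 0 < n t) {ρ : Fin d}
    (hρ : ∀ s, n s = (if s = ρ then 1 else 0) + ∑ t, edgeCount N s t) :
    treeCount Sigma.fst ρ (fun v s => (κ v s : ℕ)) *
        ∏ᶠ k : ℕ, k.factorial ^ indegreeCount N k =
      (∏ t, (n t - 1).factorial) * treeSum ρ (edgeCount N) := by
  have hτ : Function.Surjective (Sigma.fst : Vertex n → Fin d) := fun t => ⟨⟨t, 0, hn t⟩, rfl⟩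
  have := treeCount_mul_prod_factorial hτ ρ (fun v s => (κ v s : ℕ)) fun s => by
    rw [typeCard_fst, h.sum_eq, hρ]
  simp only [typeCard_fst, h.prod_factorial_eq] at this
  rw [this]
  congr 2
  funext s t
  exact h.edgeSum_eq s t

/-- The indegree types of the vertices of a tree. -/
noncomputable def ParentMap.indegreeTypes (T : ParentMap (Vertex n)) (v : Vertex n) :
    IndegreeType n :=
  fun s => ⟨T.children Sigma.fst v s, by
    have h1 := T.sum_children Sigma.fst s
    have h2 := Finset.single_le_sum (f := fun u => T.children Sigma.fst u s)
      (fun _ _ => Nat.zero_le _) (Finset.mem_univ v)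
    rw [typeCard_fst] at h1
    omega⟩

theorem numChildren_eq (T : RootedTree (Vertex n)) (s : Fin d) (v : Vertex n) :
    numChildren T s v = T.toParentMap.children Sigma.fst v s := by
  classical
  rw [numChildren, Finset.card_filter]
  refine Finset.sum_congr rfl fun w _ => if_congr ?_ rfl rfl
  rw [← T.toParentMap_parent_iff, and_comm, and_assoc]
  rfl

theorem hasIndegreeType_iff (T : RootedTree (Vertex n)) (v : Vertex n) (c : IndegreeType n) :
    HasIndegreeType T v c ↔ T.toParentMap.indegreeTypes v = c := by
  simp only [HasIndegreeType, numChildren_eq, funext_iff, Fin.ext_iff, indegreeTypes]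

theorem mem_treesWithIndegreeTypes_iff {ρ : Fin d} {N : Fin d → IndegreeType n → ℕ}
    {T : RootedTree (Vertex n)} : T ∈ treesWithIndegreeTypes n ρ N ↔
      T.toParentMap.root.1 = ρ ∧ IsAssignment N T.toParentMap.indegreeTypes := by
  simp only [treesWithIndegreeTypes, multitypeTrees, Finset.mem_filter, Finset.mem_univ, true_and,
    hasIndegreeType_iff, IsAssignment, Fintype.card_subtype]
  refine and_congr Iff.rfl (forall₂_congr fun t c => ?_)
  rw [Finset.filter_congr_decidable]

/-- Each tree determines its assignment of indegree types, so it is counted for exactly one `κ`. -/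
theorem card_treesWithIndegreeTypes (ρ : Fin d) (N : Fin d → IndegreeType n → ℕ) :
    (treesWithIndegreeTypes n ρ N).card =
      ∑ κ : {κ // IsAssignment N κ}, treeCount Sigma.fst ρ (fun v s => (κ.1 v s : ℕ)) := by
  have h : ∀ T : ParentMap (Vertex n), (∑ κ : {κ // IsAssignment N κ},
      if T.root.1 = ρ ∧ ∀ u s, T.children Sigma.fst u s = (κ.1 u s : ℕ) then 1 else 0) =
      if T.root.1 = ρ ∧ IsAssignment N T.indegreeTypes then 1 else 0 := by
    intro T
    split_ifs with hT
    · rw [Fintype.sum_eq_single ⟨T.indegreeTypes, hT.2⟩, if_pos ⟨hT.1, fun _ _ => rfl⟩]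
      refine fun κ hκ => if_neg fun h => hκ (Subtype.ext ?_)
      funext v s
      exact Fin.ext (h.2 v s).symm
    · refine Finset.sum_eq_zero fun κ _ => if_neg fun h => hT ⟨h.1, ?_⟩
      have : T.indegreeTypes = κ := by
        funext v s
        exact Fin.ext (h.2 v s)
      rw [this]
      exact κ.2
  simp only [treeCount]
  rw [Finset.sum_comm]
  refine Eq.trans ?_ (Finset.sum_congr rfl fun T _ => (by convert h T)).symm
  rw [← Finset.card_filter]
  refine Finset.card_equiv (rootedTreeEquiv (Vertex n)) fun T => ?_
  rw [mem_treesWithIndegreeTypes_iff, Finset.mem_filter]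
  exact (and_iff_right (Finset.mem_univ _)).symm

end Assignments

/-! ### Conclusion -/

theorem treeSum_eq_sum_cayleyTrees {d : ℕ} (ρ : Fin d) (m : Fin d → Fin d → ℕ) :
    treeSum ρ m = ∑ A ∈ cayleyTrees d ρ, ∏ e ∈ A.arcs, m e.1 e.2 := by
  classical
  rw [treeSum, cayleyTrees, Finset.sum_filter]
  refine (Fintype.sum_equiv (rootedTreeEquiv (Fin d)) _ _ fun A => ?_).symm
  refine if_congr Iff.rfl ?_ rfl
  rw [RootedTree.arcs, Finset.prod_filter, Fintype.prod_prod_type, weight]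
  refine Finset.prod_congr rfl fun s _ => ?_
  simp only [← A.toParentMap_parent_iff]
  change _ = if s = A.root then 1 else m s (A.toParentMap.parent s)
  by_cases hs : s = A.root <;> simp [hs]

end MultitypeCayley

theorem mainTheorem7 {d : ℕ} (n : Fin d → ℕ) (hn : ∀ t, 0 < n t) (ρ : Fin d)
    (N : Fin d → MultitypeCayley.IndegreeType n → ℕ)
    (hN : ∀ t, n t = ∑ c : MultitypeCayley.IndegreeType n, N t c) :
    ((∀ s, n s = (if s = ρ then 1 else 0) + ∑ t, MultitypeCayley.edgeCount N s t) →
      ((MultitypeCayley.treesWithIndegreeTypes n ρ N).card : ℚ) =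
        (((∏ t, (n t).factorial * (n t - 1).factorial : ℕ) : ℚ) /
          (((∏ t, ∏ c, (N t c).factorial) *
            ∏ᶠ k : ℕ, k.factorial ^ MultitypeCayley.indegreeCount N k : ℕ) : ℚ)) *
        ((∑ A ∈ MultitypeCayley.cayleyTrees d ρ,
          ∏ e ∈ A.arcs, MultitypeCayley.edgeCount N e.1 e.2 : ℕ) : ℚ)) ∧
    (¬ (∀ s, n s = (if s = ρ then 1 else 0) + ∑ t, MultitypeCayley.edgeCount N s t) →
      (MultitypeCayley.treesWithIndegreeTypes n ρ N).card = 0) := by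
  constructor
  · intro hρ
    have h1 : (∏ t, ∏ c, (N t c).factorial) *
        ∏ᶠ k : ℕ, k.factorial ^ MultitypeCayley.indegreeCount N k ≠ 0 := by
      rw [MultitypeCayley.finprod_factorial_pow_indegreeCount]
      refine mul_ne_zero ?_ ?_
      · exact Finset.prod_ne_zero_iff.2 fun t _ => Finset.prod_ne_zero_iff.2 fun c _ =>
          Nat.factorial_ne_zero _
      · exact Finset.prod_ne_zero_iff.2 fun t _ => Finset.prod_ne_zero_iff.2 fun c _ =>
          Finset.prod_ne_zero_iff.2 fun s _ => pow_ne_zero _ (Nat.factorial_ne_zero _)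
    rw [div_mul_eq_mul_div, eq_div_iff (Nat.cast_ne_zero.2 h1),
      ← MultitypeCayley.treeSum_eq_sum_cayleyTrees]
    norm_cast
    -- After multiplication by the `finprod`, every assignment contributes the same amount, so only
    -- the number of assignments remains.
    rw [MultitypeCayley.card_treesWithIndegreeTypes, mul_left_comm, Finset.sum_mul,
      Finset.sum_congr rfl fun κ _ => κ.2.treeCount_mul hn hρ, Finset.sum_const, smul_eq_mul,
      Finset.card_univ, ← mul_assoc, mul_comm (∏ t, ∏ c, _),
      MultitypeCayley.card_isAssignment hN, Finset.prod_mul_distrib, mul_assoc]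
  · intro hρ
    -- A single tree would already force the edge-count condition, by counting children of type `s`.
    refine Finset.card_eq_zero.2 (Finset.eq_empty_of_forall_notMem fun T hT => hρ fun s => ?_)
    obtain ⟨hr, hT⟩ := MultitypeCayley.mem_treesWithIndegreeTypes_iff.1 hT
    have h := T.toParentMap.sum_children Sigma.fst s
    rw [MultitypeCayley.typeCard_fst, hr] at h
    rw [← hT.sum_eq]
    exact h.symm
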